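/- Let $D$ be a division ring with center $F$, and let $F\langle x_1,x_2,\ldots\rangle$ be the free associative unital $F$-algebra in countably many noncommuting variables. For a polynomial $q$ in it and an associative unital $F$-algebra $A$, write $q(A)\subseteq A$ for the set of all values of $q$ obtained by substituting elements of $A$ for the variables. Call $q$ multilinear in the variables $y_1,\ldots,y_m$, where $m\ge 1$ and $y_1,\ldots,y_m$ are distinct elements of $\{x_1,x_2,\ldots\}$, if $$q=\sum_{\sigma\in S_m}\lambda_\sigma\, y_{\sigma(1)}y_{\sigma(2)}\cdots y_{\sigma(m)}$$ for some $\lambda_\sigma\in F$. Let $p=p_1p_2$, where $p_1,p_2\in F\langle x_1,x_2,\ldots\rangle$ are multilinear in disjoint finite sets of variables, and suppose that, for $i=1,2$, $$p_i(\mathrm{M}_2(F))\neq\{0\}\quad\text{and}\quad p_i(\mathrm{M}_2(F))\neq Z(\mathrm{M}_2(F)),$$ where $Z(\mathrm{M}_2(F))$ denotes the center of $\mathrm{M}_2(F)$, that is, the set of scalar matrices. Then $p(\mathrm{M}_2(D))=\mathrm{M}_2(D)$. -/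

import Mathlib

open scoped BigOperators

/-- `IsMultilinearIn X p` says that the noncommutative polynomial `p` in the free algebra over `F`
on countably many variables is multilinear, with (nonempty, finite) set of variables `X`: writing
`X = {v 0, ..., v (m - 1)}` with `m` positive and the `v i` distinct, `p` is a combination
of the monomials `x_{v (σ 0)} * ... * x_{v (σ (m - 1))}`, where `σ` is a permutation. -/
def IsMultilinearIn {F : Type*} [Field F] (X : Finset ℕ) (p : FreeAlgebra F ℕ) : Prop :=
  ∃ (m : ℕ) (v : Fin m ↪ ℕ) (c : Equiv.Perm (Fin m) → F),
    0 < m ∧ Finset.univ.map v = X ∧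
      p = ∑ σ : Equiv.Perm (Fin m),
        c σ • (List.ofFn fun i : Fin m => FreeAlgebra.ι F (v (σ i))).prod

/-- The image of the noncommutative polynomial `p` evaluated on the algebra `A`: the set of all
values of `p` under substitution of elements of `A` for the variables. -/
def polyImage {F : Type*} [Field F] (A : Type*) [Ring A] [Algebra F A]
    (p : FreeAlgebra F ℕ) : Set A :=
  {y | ∃ a : ℕ → A, FreeAlgebra.lift F a p = y}

/-! Values of a polynomial are closed under conjugation, so it suffices to factor matrices over `D`
up to similarity. A diagonal matrix is a product of two antidiagonal ones; any other is similar to a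
companion matrix, which `exists_mul_eq_of_antidiagonal_mem` factors using antidiagonal matrices,
their conjugates and one invertible diagonal matrix.

All antidiagonal matrices over `D` are values of each factor (`antidiagonal_mem_range`). Some tuple
of matrix units over `F` has a nonzero multiple of E₀₁ as value, and swapping the indices gives a
multiple of E₁₀. Hence a multilinear map into the antidiagonal plane has two independent values, and
by `MultilinearMap.exists_slice_det_ne_zero` a single variable already fills the plane. Scalars from
`D` commute with matrices over `F`, so they can be inserted in that one variable. -/

/-! ### Multilinear polynomials and multilinear maps. -/

section Multilinear

variable {F : Type*} [Field F]

/-- The multilinear map on an algebra `A` given by a multilinear noncommutative polynomial with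
coefficients `c`. -/
def multilinearEval {m : ℕ} (c : Equiv.Perm (Fin m) → F) (A : Type*) [Ring A] [Algebra F A] :
    MultilinearMap F (fun _ : Fin m => A) A :=
  ∑ σ : Equiv.Perm (Fin m), c σ • (MultilinearMap.mkPiAlgebraFin F m A).domDomCongr σ

theorem multilinearEval_apply {m : ℕ} (c : Equiv.Perm (Fin m) → F) {A : Type*} [Ring A]
    [Algebra F A] (x : Fin m → A) :
    multilinearEval c A x = ∑ σ : Equiv.Perm (Fin m), c σ • (List.ofFn fun i => x (σ i)).prod := by
  simp [multilinearEval]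

theorem multilinearEval_map {m : ℕ} (c : Equiv.Perm (Fin m) → F) {A B : Type*} [Ring A]
    [Algebra F A] [Ring B] [Algebra F B] (φ : A →ₐ[F] B) (x : Fin m → A) :
    multilinearEval c B (fun i => φ (x i)) = φ (multilinearEval c A x) := by
  simp only [multilinearEval_apply, map_sum, map_smul, map_list_prod, List.map_ofFn]
  rfl

theorem List.prod_ofFn_update_mul {A : Type*} [Monoid A] {n : ℕ} (x : Fin n → A) (i : Fin n)
    (z : A) (hz : ∀ j, Commute z (x j)) :
    (List.ofFn (Function.update x i (x i * z))).prod = (List.ofFn x).prod * z := by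
  induction n with
  | zero => exact i.elim0
  | succ n ih =>
    rw [List.ofFn_succ, List.ofFn_succ, List.prod_cons, List.prod_cons]
    refine Fin.cases ?_ (fun i => ?_) i
    · have h : Commute z (List.ofFn fun i : Fin n => x i.succ).prod := by
        refine Commute.list_prod_right _ _ fun y hy => ?_
        obtain ⟨j, rfl⟩ := List.mem_ofFn.1 hy
        exact hz _
      simp [mul_assoc, h.eq]
    · have h := ih (fun j => x j.succ) i (fun j => hz _)
      have e : (fun j : Fin n => Function.update x i.succ (x i.succ * z) j.succ) =
          Function.update (fun j : Fin n => x j.succ) i (x i.succ * z) := by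
        funext j
        by_cases hj : j = i
        · subst hj; simp
        · simp [hj]
      rw [e, h, Function.update_of_ne (Fin.succ_ne_zero i).symm, mul_assoc]

/-- Since `z` commutes with every argument, it moves to the right end of each monomial. This lets
one variable absorb scalars from `D`. -/
theorem multilinearEval_update_mul {m : ℕ} (c : Equiv.Perm (Fin m) → F) {A : Type*} [Ring A]
    [Algebra F A] (x : Fin m → A) (i : Fin m) (z : A) (hz : ∀ j, Commute z (x j)) :
    multilinearEval c A (Function.update x i (x i * z)) = multilinearEval c A x * z := by
  simp only [multilinearEval_apply, Finset.sum_mul, smul_mul_assoc]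
  refine Finset.sum_congr rfl fun σ _ => ?_
  have e : (fun j => Function.update x i (x i * z) (σ j)) =
      Function.update (fun j => x (σ j)) (σ.symm i) (x (σ (σ.symm i)) * z) := by
    funext j
    by_cases hj : j = σ.symm i
    · subst hj; simp
    · have : σ j ≠ i := fun h => hj (by simp [← h])
      simp [hj, this]
  rw [e, List.prod_ofFn_update_mul (fun j => x (σ j)) (σ.symm i) z (fun j => hz _)]

theorem lift_eq_multilinearEval {m : ℕ} (c : Equiv.Perm (Fin m) → F) (v : Fin m → ℕ)
    {A : Type*} [Ring A] [Algebra F A] (a : ℕ → A) :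
    FreeAlgebra.lift F a (∑ σ : Equiv.Perm (Fin m),
        c σ • (List.ofFn fun i : Fin m => FreeAlgebra.ι F (v (σ i))).prod) =
      multilinearEval c A (fun i => a (v i)) := by
  simp only [multilinearEval_apply, map_sum, map_smul, map_list_prod, List.map_ofFn]
  congr! with σ _
  simp

theorem polyImage_eq_range {m : ℕ} (c : Equiv.Perm (Fin m) → F) (v : Fin m ↪ ℕ)
    {A : Type*} [Ring A] [Algebra F A] :
    polyImage A (∑ σ : Equiv.Perm (Fin m),
        c σ • (List.ofFn fun i : Fin m => FreeAlgebra.ι F (v (σ i))).prod) =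
      Set.range (multilinearEval c A) := by
  ext y
  simp only [polyImage, Set.mem_ofPred_eq, lift_eq_multilinearEval, Set.mem_range]
  constructor
  · rintro ⟨a, h⟩
    exact ⟨_, h⟩
  · rintro ⟨x, h⟩
    refine ⟨Function.extend v x 0, ?_⟩
    simpa [v.injective.extend_apply] using h

theorem mul_mem_polyImage_mul {X₁ X₂ : Finset ℕ} (hX : Disjoint X₁ X₂) {p₁ p₂ : FreeAlgebra F ℕ}
    (h₁ : IsMultilinearIn X₁ p₁) (h₂ : IsMultilinearIn X₂ p₂) {A : Type*} [Ring A] [Algebra F A]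
    {y z : A} (hy : y ∈ polyImage A p₁) (hz : z ∈ polyImage A p₂) :
    y * z ∈ polyImage A (p₁ * p₂) := by
  classical
  obtain ⟨m, v, c, -, rfl, rfl⟩ := h₁
  obtain ⟨n, w, d, -, rfl, rfl⟩ := h₂
  obtain ⟨a, rfl⟩ := hy
  obtain ⟨b, rfl⟩ := hz
  refine ⟨fun k => if k ∈ Finset.univ.map v then a k else b k, ?_⟩
  rw [map_mul]
  simp only [lift_eq_multilinearEval]
  congr 2
  · funext i
    simp
  · funext i
    have : w i ∉ Finset.univ.map v := fun h =>
      Finset.disjoint_left.1 hX h (Finset.mem_map_of_mem _ (Finset.mem_univ _))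
    rw [if_neg this]

theorem map_mem_polyImage {p : FreeAlgebra F ℕ} {A B : Type*} [Ring A] [Algebra F A] [Ring B]
    [Algebra F B] (φ : A →ₐ[F] B) {y : A} (hy : y ∈ polyImage A p) : φ y ∈ polyImage B p := by
  obtain ⟨a, rfl⟩ := hy
  refine ⟨φ ∘ a, ?_⟩
  rw [← AlgHom.comp_apply]
  congr 1
  ext
  simp

/-- Conjugation by a unit, as an algebra endomorphism. -/
def conjHom (F : Type*) [Field F] {A : Type*} [Ring A] [Algebra F A] (u : Aˣ) : A →ₐ[F] A where
  toFun x := u * x * ↑u⁻¹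
  map_one' := by simp
  map_mul' x y := by simp [mul_assoc]
  map_zero' := by simp
  map_add' x y := by simp [mul_add, add_mul]
  commutes' r := by simp [← Algebra.commutes r (u : A), mul_assoc]

theorem conj_mem_polyImage {p : FreeAlgebra F ℕ} {A : Type*} [Ring A] [Algebra F A] {u w y : A}
    (huw : u * w = 1) (hwu : w * u = 1) (hy : y ∈ polyImage A p) : u * y * w ∈ polyImage A p :=
  map_mem_polyImage (conjHom F ⟨u, w, huw, hwu⟩) hy

/-- Two nonzero multilinear maps have a common point where neither vanishes, over any field. -/
theorem MultilinearMap.exists_ne_zero_and_ne_zero {V W W' : Type*} [AddCommGroup V] [Module F V]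
    [AddCommGroup W] [Module F W] [AddCommGroup W'] [Module F W'] {n : ℕ}
    (f : MultilinearMap F (fun _ : Fin n => V) W) (g : MultilinearMap F (fun _ : Fin n => V) W')
    (hf : ∃ x, f x ≠ 0) (hg : ∃ x, g x ≠ 0) : ∃ x, f x ≠ 0 ∧ g x ≠ 0 := by
  induction n with
  | zero =>
    obtain ⟨x, hx⟩ := hf
    obtain ⟨y, hy⟩ := hg
    exact ⟨x, hx, by rwa [Subsingleton.elim x y]⟩
  | succ n ih =>
    obtain ⟨x, hx⟩ := hf
    obtain ⟨y, hy⟩ := hg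
    have key : ∃ v, f.curryLeft v ≠ 0 ∧ g.curryLeft v ≠ 0 := by
      have hx' : f.curryLeft (x 0) ≠ 0 := fun h => hx <| by
        have := congrArg (fun k => k (Fin.tail x)) h
        simpa using this
      have hy' : g.curryLeft (y 0) ≠ 0 := fun h => hy <| by
        have := congrArg (fun k => k (Fin.tail y)) h
        simpa using this
      -- One of `x 0`, `y 0`, `x 0 + y 0` always works, so finite fields need no separate treatment.
      by_cases h1 : g.curryLeft (x 0) = 0
      · by_cases h2 : f.curryLeft (y 0) = 0
        · exact ⟨x 0 + y 0, by rwa [map_add, h2, add_zero], by rwa [map_add, h1, zero_add]⟩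
        · exact ⟨y 0, h2, hy'⟩
      · exact ⟨x 0, hx', h1⟩
    obtain ⟨v, hv, hv'⟩ := key
    obtain ⟨z, hz, hz'⟩ := ih (f.curryLeft v) (g.curryLeft v)
      (by by_contra! h; exact hv (MultilinearMap.ext h))
      (by by_contra! h; exact hv' (MultilinearMap.ext h))
    exact ⟨Fin.cons v z, hz, hz'⟩

theorem exists_eq_smul_of_det_eq_zero {a b : Fin 2 → F} (hb : b ≠ 0)
    (hab : a 0 * b 1 - a 1 * b 0 = 0) : ∃ t : F, a = t • b := by
  by_cases h0 : b 0 = 0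
  · have h1 : b 1 ≠ 0 := fun h1 => hb (by ext i; fin_cases i <;> simp [h0, h1])
    refine ⟨a 1 / b 1, ?_⟩
    ext i
    fin_cases i
    · have : a 0 * b 1 = 0 := by linear_combination hab + a 1 * h0
      simpa [h0, h1] using this
    · simp [h1]
  · refine ⟨a 0 / b 0, ?_⟩
    ext i
    fin_cases i
    · simp [h0]
    · simp only [Fin.mk_one, Pi.smul_apply, smul_eq_mul]
      field_simp
      linear_combination -hab

/-- If the values of a multilinear map to the plane are not all on one line, then already varying
a single variable gives two linearly independent values. -/
theorem MultilinearMap.exists_slice_det_ne_zero {V : Type*} [AddCommGroup V] [Module F V] {n : ℕ}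
    (T : MultilinearMap F (fun _ : Fin n => V) (Fin 2 → F))
    (h : ∃ x y, T x 0 * T y 1 - T x 1 * T y 0 ≠ 0) :
    ∃ x i, ∃ u v : V, T (Function.update x i u) 0 * T (Function.update x i v) 1 -
      T (Function.update x i u) 1 * T (Function.update x i v) 0 ≠ 0 := by
  induction n with
  | zero =>
    obtain ⟨x, y, hxy⟩ := h
    rw [Subsingleton.elim x y] at hxy
    exact absurd (by ring) hxy
  | succ n ih =>
    obtain ⟨x, y, hxy⟩ := h
    by_cases hv : ∃ v : V, ∃ z w, T (Fin.cons v z) 0 * T (Fin.cons v w) 1 -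
        T (Fin.cons v z) 1 * T (Fin.cons v w) 0 ≠ 0
    · obtain ⟨v, z, w, hzw⟩ := hv
      obtain ⟨x, i, a, b, hab⟩ := ih (T.curryLeft v) ⟨z, w, hzw⟩
      refine ⟨Fin.cons v x, i.succ, a, b, ?_⟩
      rw [← Fin.cons_update, ← Fin.cons_update]
      exact hab
    -- Now each fixed first variable confines the values to a line. A common `z` with both values
    -- nonzero spans the lines of `x 0` and `y 0`, which differ because `T x` and `T y` are
    -- independent.
    · push Not at hv
      have hx : T x ≠ 0 := fun h => hxy (by simp [h])
      have hy : T y ≠ 0 := fun h => hxy (by simp [h])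
      rw [← Fin.cons_self_tail x] at hx hxy
      rw [← Fin.cons_self_tail y] at hy hxy
      obtain ⟨z, hz, hz'⟩ := MultilinearMap.exists_ne_zero_and_ne_zero (T.curryLeft (x 0))
        (T.curryLeft (y 0)) ⟨_, hx⟩ ⟨_, hy⟩
      rw [MultilinearMap.curryLeft_apply] at hz hz'
      refine ⟨Fin.cons (x 0) z, 0, x 0, y 0, ?_⟩
      rw [Fin.update_cons_zero, Fin.update_cons_zero]
      obtain ⟨s, hs⟩ := exists_eq_smul_of_det_eq_zero hz (hv (x 0) (Fin.tail x) z)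
      obtain ⟨t, ht⟩ := exists_eq_smul_of_det_eq_zero hz' (hv (y 0) (Fin.tail y) z)
      intro h
      rw [hs, ht] at hxy
      apply hxy
      simp only [Pi.smul_apply, smul_eq_mul]
      linear_combination s * t * h

end Multilinear

/-! ### Gradings and the index swap on matrices. -/

section TwoByTwo

open Matrix

variable {F : Type*} [Field F]

/-- Giving the entry (i, j) degree `δ j - δ i` grades the matrix algebra. As `G` is commutative, all
monomials have the same degree, whatever the order of their factors. -/
theorem multilinearEval_apply_eq_zero_of_degree {G : Type*} [AddCommGroup G] {ι R : Type*}
    [Fintype ι] [DecidableEq ι] [Ring R] [Algebra F R] (δ : ι → G) {m : ℕ}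
    (c : Equiv.Perm (Fin m) → F) (k : Fin m → G) (x : Fin m → Matrix ι ι R)
    (hx : ∀ l i j, δ j - δ i ≠ k l → x l i j = 0) {i j : ι} (hij : δ j - δ i ≠ ∑ l, k l) :
    multilinearEval c (Matrix ι ι R) x i j = 0 := by
  have key : ∀ (n : ℕ) (k : Fin n → G) (x : Fin n → Matrix ι ι R)
      (_ : ∀ l i j, δ j - δ i ≠ k l → x l i j = 0) (i j : ι), δ j - δ i ≠ ∑ l, k l →
      (List.ofFn x).prod i j = 0 := by
    intro n
    induction n with
    | zero =>
      intro k x _ i j h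
      have : i ≠ j := by rintro rfl; simp at h
      simp [Matrix.one_apply_ne this]
    | succ n ih =>
      intro k x hx i j h
      rw [List.ofFn_succ, List.prod_cons, Matrix.mul_apply]
      refine Finset.sum_eq_zero fun l _ => ?_
      by_cases h0 : δ l - δ i = k 0
      · rw [ih (fun q => k q.succ) (fun q => x q.succ) (fun q => hx _) l j, mul_zero]
        intro h1
        apply h
        rw [Fin.sum_univ_succ, ← h0, ← h1]
        abel
      · rw [hx 0 i l h0, zero_mul]
  rw [multilinearEval_apply, Matrix.sum_apply]
  refine Finset.sum_eq_zero fun σ _ => ?_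
  rw [Matrix.smul_apply, key m (fun l => k (σ l)) (fun l => x (σ l)) (fun l => hx _) i j, smul_zero]
  rwa [Equiv.sum_comp σ k]

theorem exists_single_multilinearEval_apply_ne_zero {ι : Type*} [Fintype ι] [DecidableEq ι] {m : ℕ}
    (c : Equiv.Perm (Fin m) → F) {i j : ι}
    (h : ∃ x, multilinearEval c (Matrix ι ι F) x i j ≠ 0) :
    ∃ (r : Fin m → ι × ι) (a : Fin m → F),
      multilinearEval c (Matrix ι ι F) (fun l => Matrix.single (r l).1 (r l).2 (a l)) i j ≠ 0 := by
  by_contra! hc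
  obtain ⟨x, hx⟩ := h
  apply hx
  have e : x = fun l => ∑ q : ι × ι, Matrix.single q.1 q.2 (x l q.1 q.2) := by
    funext l
    rw [Fintype.sum_prod_type]
    exact Matrix.matrix_eq_sum_single (x l)
  rw [e, MultilinearMap.map_sum, Matrix.sum_apply]
  exact Finset.sum_eq_zero fun r _ => hc r fun l => x l (r l).1 (r l).2

/-- The parity grading on two by two matrices: diagonal and antidiagonal entries. -/
def parityMatrix (F : Type*) [Field F] (k : ZMod 2) :
    (Fin 2 → F) →ₗ[F] Matrix (Fin 2) (Fin 2) F where
  toFun w := if k = 0 then !![w 0, 0; 0, w 1] else !![0, w 0; w 1, 0]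
  map_add' u w := by split_ifs <;> ext i j <;> fin_cases i <;> fin_cases j <;> simp
  map_smul' a w := by split_ifs <;> ext i j <;> fin_cases i <;> fin_cases j <;> simp

/-- The component of a two by two matrix in a given parity. -/
def parityCoord (F : Type*) [Field F] (k : ZMod 2) :
    Matrix (Fin 2) (Fin 2) F →ₗ[F] (Fin 2 → F) where
  toFun A := if k = 0 then ![A 0 0, A 1 1] else ![A 0 1, A 1 0]
  map_add' A B := by split_ifs <;> ext i <;> fin_cases i <;> simp
  map_smul' a A := by split_ifs <;> ext i <;> fin_cases i <;> simp

theorem parityMatrix_parityCoord (k : ZMod 2) (A : Matrix (Fin 2) (Fin 2) F)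
    (hA : ∀ i j, (![0, 1] : Fin 2 → ZMod 2) j - (![0, 1] : Fin 2 → ZMod 2) i ≠ k → A i j = 0) :
    parityMatrix F k (parityCoord F k A) = A := by
  simp only [parityMatrix, parityCoord, LinearMap.coe_mk, AddHom.coe_mk]
  rcases (by decide : ∀ k : ZMod 2, k = 0 ∨ k = 1) k with rfl | rfl
  · have h01 := hA 0 1 (by decide)
    have h10 := hA 1 0 (by decide)
    ext i j
    fin_cases i <;> fin_cases j <;> simp [h01, h10]
  · have h00 := hA 0 0 (by decide)
    have h11 := hA 1 1 (by decide)
    ext i j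
    fin_cases i <;> fin_cases j <;> simp [h00, h11]

theorem parityMatrix_apply_eq_zero (k : ZMod 2) (w : Fin 2 → F) (i j : Fin 2)
    (h : (![0, 1] : Fin 2 → ZMod 2) j - (![0, 1] : Fin 2 → ZMod 2) i ≠ k) :
    parityMatrix F k w i j = 0 := by
  simp only [parityMatrix, LinearMap.coe_mk, AddHom.coe_mk]
  revert h
  rcases (by decide : ∀ k : ZMod 2, k = 0 ∨ k = 1) k with rfl | rfl <;>
    fin_cases i <;> fin_cases j <;> simp

/-- The multilinear evaluation on homogeneous matrices of prescribed parities. -/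
def parityEval {m : ℕ} (c : Equiv.Perm (Fin m) → F) (k : Fin m → ZMod 2) :
    MultilinearMap F (fun _ : Fin m => Fin 2 → F) (Fin 2 → F) :=
  (parityCoord F (∑ l, k l)).compMultilinearMap
    ((multilinearEval c (Matrix (Fin 2) (Fin 2) F)).compLinearMap fun l => parityMatrix F (k l))

theorem parityMatrix_parityEval {m : ℕ} (c : Equiv.Perm (Fin m) → F) (k : Fin m → ZMod 2)
    (w : Fin m → Fin 2 → F) :
    parityMatrix F (∑ l, k l) (parityEval c k w) =
      multilinearEval c (Matrix (Fin 2) (Fin 2) F) fun l => parityMatrix F (k l) (w l) :=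
  parityMatrix_parityCoord _ _ fun _ _ h =>
    multilinearEval_apply_eq_zero_of_degree ![0, 1] c k _
      (fun _ _ _ => parityMatrix_apply_eq_zero _ _ _ _) h

theorem swap_mul_swap (R : Type*) [Ring R] :
    (!![0, 1; 1, 0] : Matrix (Fin 2) (Fin 2) R) * !![0, 1; 1, 0] = 1 := by
  simp [Matrix.one_fin_two]

theorem swap_conj {R : Type*} [Ring R] (A : Matrix (Fin 2) (Fin 2) R) :
    (!![0, 1; 1, 0] : Matrix (Fin 2) (Fin 2) R) * A * !![0, 1; 1, 0] =
      !![A 1 1, A 1 0; A 0 1, A 0 0] := by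
  conv_lhs => rw [A.eta_fin_two]
  simp

theorem multilinearEval_conj {m : ℕ} (c : Equiv.Perm (Fin m) → F) {A : Type*} [Ring A]
    [Algebra F A] {u w : A} (huw : u * w = 1) (hwu : w * u = 1) (x : Fin m → A) :
    multilinearEval c A (fun l => u * x l * w) = u * multilinearEval c A x * w :=
  multilinearEval_map c (conjHom F ⟨u, w, huw, hwu⟩) x

theorem multilinearEval_swap {m : ℕ} (c : Equiv.Perm (Fin m) → F)
    (x : Fin m → Matrix (Fin 2) (Fin 2) F) (i j : Fin 2) :
    multilinearEval c (Matrix (Fin 2) (Fin 2) F)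
        (fun l => !![x l 1 1, x l 1 0; x l 0 1, x l 0 0]) i j =
      multilinearEval c (Matrix (Fin 2) (Fin 2) F) x (1 - i) (1 - j) := by
  have h := multilinearEval_conj c (swap_mul_swap F) (swap_mul_swap F) x
  simp only [swap_conj] at h
  rw [h]
  fin_cases i <;> fin_cases j <;> rfl

/-- Coordinate `i` is the entry in row `i` for both parities, so conjugation by the swap matrix
exchanges the two coordinates. -/
theorem parityEval_swap {m : ℕ} (c : Equiv.Perm (Fin m) → F) (k : Fin m → ZMod 2)
    (w : Fin m → Fin 2 → F) (i : Fin 2) :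
    parityEval c k (fun l j => w l (1 - j)) i = parityEval c k w (1 - i) := by
  have e : (fun l => parityMatrix F (k l) (fun j => w l (1 - j))) = fun l =>
      !![parityMatrix F (k l) (w l) 1 1, parityMatrix F (k l) (w l) 1 0;
        parityMatrix F (k l) (w l) 0 1, parityMatrix F (k l) (w l) 0 0] := by
    funext l
    simp only [parityMatrix, LinearMap.coe_mk, AddHom.coe_mk]
    split_ifs <;> simp
  have h := multilinearEval_swap c (fun l => parityMatrix F (k l) (w l))
  rw [← e] at h
  simp only [parityEval, parityCoord, LinearMap.compMultilinearMap_apply,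
    MultilinearMap.compLinearMap_apply, LinearMap.coe_mk, AddHom.coe_mk]
  split_ifs <;> fin_cases i <;> simp [h]

end TwoByTwo

/-! ### Values over the base field. -/

section Values

open Matrix

variable {F : Type*} [Field F]

/-- Otherwise conjugation by the swap and by a unipotent matrix forces every value to be scalar;
rescaling one variable then gives either zero or the whole center. -/
theorem exists_multilinearEval_zero_one_ne_zero {m : ℕ} (hm : 0 < m) (c : Equiv.Perm (Fin m) → F)
    (h0 : Set.range (multilinearEval c (Matrix (Fin 2) (Fin 2) F)) ≠ {0})
    (hc : Set.range (multilinearEval c (Matrix (Fin 2) (Fin 2) F)) ≠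
      Set.center (Matrix (Fin 2) (Fin 2) F)) :
    ∃ x, multilinearEval c (Matrix (Fin 2) (Fin 2) F) x 0 1 ≠ 0 := by
  by_contra! h01
  have h10 : ∀ x, multilinearEval c (Matrix (Fin 2) (Fin 2) F) x 1 0 = 0 := fun x => by
    rw [← h01 fun l => !![x l 1 1, x l 1 0; x l 0 1, x l 0 0], multilinearEval_swap]
    rfl
  have h11 : ∀ x, multilinearEval c (Matrix (Fin 2) (Fin 2) F) x 1 1 =
      multilinearEval c (Matrix (Fin 2) (Fin 2) F) x 0 0 := fun x => by
    have h := h01 fun l => !![1, 1; 0, 1] * x l * !![1, -1; 0, 1]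
    rw [multilinearEval_conj c (by simp [Matrix.one_fin_two]) (by simp [Matrix.one_fin_two]),
      Matrix.eta_fin_two (multilinearEval c _ x), h01, h10] at h
    simp at h
    linear_combination h
  have hs : ∀ x, multilinearEval c (Matrix (Fin 2) (Fin 2) F) x =
      Matrix.scalar (Fin 2) (multilinearEval c (Matrix (Fin 2) (Fin 2) F) x 0 0) := fun x => by
    ext i j
    fin_cases i <;> fin_cases j <;> simp [h01, h10, h11]
  have hne : ∃ x, multilinearEval c (Matrix (Fin 2) (Fin 2) F) x 0 0 ≠ 0 := by
    by_contra! h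
    have hz : ∀ x, multilinearEval c (Matrix (Fin 2) (Fin 2) F) x = 0 := fun x => by
      rw [hs, h, map_zero]
    exact h0 (Set.eq_singleton_iff_nonempty_unique_mem.2
      ⟨Set.range_nonempty _, by rintro _ ⟨x, rfl⟩; exact hz x⟩)
  obtain ⟨x, hx⟩ := hne
  apply hc
  rw [Matrix.center_eq_range]
  ext y
  constructor
  · rintro ⟨z, rfl⟩
    exact ⟨_, (hs z).symm⟩
  · rintro ⟨t, rfl⟩
    refine ⟨Function.update x ⟨0, hm⟩
      ((t / multilinearEval c (Matrix (Fin 2) (Fin 2) F) x 0 0) • x ⟨0, hm⟩), ?_⟩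
    rw [MultilinearMap.map_update_smul, Function.update_eq_self, hs x]
    ext i j
    fin_cases i <;> fin_cases j <;> simp [hx]

theorem exists_multilinearEval_zero_zero_ne_zero {m : ℕ} (c : Equiv.Perm (Fin m) → F)
    (h : ∃ x, multilinearEval c (Matrix (Fin 2) (Fin 2) F) x 0 1 ≠ 0) :
    ∃ x, multilinearEval c (Matrix (Fin 2) (Fin 2) F) x 0 0 ≠ 0 := by
  by_contra! h00
  have h11 : ∀ x, multilinearEval c (Matrix (Fin 2) (Fin 2) F) x 1 1 = 0 := fun x => by
    rw [← h00 fun l => !![x l 1 1, x l 1 0; x l 0 1, x l 0 0], multilinearEval_swap]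
    rfl
  obtain ⟨x, hx⟩ := h
  have h := h00 fun l => !![1, 0; -1, 1] * x l * !![1, 0; 1, 1]
  rw [multilinearEval_conj c (by simp [Matrix.one_fin_two]) (by simp [Matrix.one_fin_two]),
    Matrix.eta_fin_two (multilinearEval c _ x), h00, h11] at h
  simp at h
  exact hx h

theorem single_eq_parityMatrix (i j : Fin 2) (a : F) :
    Matrix.single i j a =
      parityMatrix F ((![0, 1] : Fin 2 → ZMod 2) j - (![0, 1] : Fin 2 → ZMod 2) i)
        (Pi.single i a) := by
  simp only [parityMatrix, LinearMap.coe_mk, AddHom.coe_mk]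
  ext p q
  fin_cases i <;> fin_cases j <;> fin_cases p <;> fin_cases q <;> simp

theorem sum_degree_of_single {G : Type*} [AddCommGroup G] {ι : Type*} [Fintype ι] [DecidableEq ι]
    (δ : ι → G) {m : ℕ} (c : Equiv.Perm (Fin m) → F) (r : Fin m → ι × ι) (a : Fin m → F) {i j : ι}
    (h : multilinearEval c (Matrix ι ι F) (fun l => Matrix.single (r l).1 (r l).2 (a l)) i j ≠ 0) :
    ∑ l, (δ (r l).2 - δ (r l).1) = δ j - δ i := by
  by_contra hne
  refine h (multilinearEval_apply_eq_zero_of_degree δ c _ _ (fun l p q hpq => ?_) (Ne.symm hne))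
  refine Matrix.single_apply_of_ne _ _ _ _ _ fun ⟨h1, h2⟩ => hpq ?_
  rw [h1, h2]

theorem exists_parityEval_surjective {m : ℕ} (c : Equiv.Perm (Fin m) → F)
    (h : ∃ x, multilinearEval c (Matrix (Fin 2) (Fin 2) F) x 0 1 ≠ 0) :
    ∃ (k : Fin m → ZMod 2) (x : Fin m → Fin 2 → F) (i : Fin m), ∑ l, k l = 1 ∧
      ∀ e, ∃ u, parityEval c k (Function.update x i u) = e := by
  obtain ⟨r, a, hra⟩ := exists_single_multilinearEval_apply_ne_zero c h
  -- The integer grading separates the two antidiagonal entries, of degrees 1 and -1, which parity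
  -- cannot do.
  have h10 : multilinearEval c (Matrix (Fin 2) (Fin 2) F)
      (fun l => Matrix.single (r l).1 (r l).2 (a l)) 1 0 = 0 := by
    by_contra hne
    have h1 := sum_degree_of_single (![0, 1] : Fin 2 → ℤ) c r a hra
    rw [sum_degree_of_single (![0, 1] : Fin 2 → ℤ) c r a hne] at h1
    simp at h1
  have hk := sum_degree_of_single (![0, 1] : Fin 2 → ZMod 2) c r a hra
  simp only [single_eq_parityMatrix] at hra h10
  set k : Fin m → ZMod 2 := fun l =>
    (![0, 1] : Fin 2 → ZMod 2) (r l).2 - (![0, 1] : Fin 2 → ZMod 2) (r l).1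
  have hk1 : ∑ l, k l = 1 := by simpa using hk
  set w : Fin m → Fin 2 → F := fun l => Pi.single (r l).1 (a l)
  have hT : ∀ i, parityEval c k w i = multilinearEval c (Matrix (Fin 2) (Fin 2) F)
      (fun l => parityMatrix F (k l) (w l)) i (1 - i) := by
    intro i
    rw [← parityMatrix_parityEval, hk1]
    simp only [parityMatrix, LinearMap.coe_mk, AddHom.coe_mk]
    fin_cases i <;> simp
  have hT0 : parityEval c k w 0 ≠ 0 := by rw [hT]; exact hra
  have hT1 : parityEval c k w 1 = 0 := by rw [hT]; exact h10
  obtain ⟨x, i, u, v, hd⟩ := MultilinearMap.exists_slice_det_ne_zero (parityEval c k)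
    ⟨w, fun l j => w l (1 - j), by
      rw [parityEval_swap, parityEval_swap]
      simpa [hT1] using hT0⟩
  refine ⟨k, x, i, hk1, fun e => ?_⟩
  set p := parityEval c k (Function.update x i u)
  set q := parityEval c k (Function.update x i v)
  -- Cramer's rule for writing `e` in the basis `p`, `q`.
  refine ⟨((p 0 * q 1 - p 1 * q 0)⁻¹ * (e 0 * q 1 - e 1 * q 0)) • u +
    ((p 0 * q 1 - p 1 * q 0)⁻¹ * (p 0 * e 1 - p 1 * e 0)) • v, ?_⟩
  rw [MultilinearMap.map_update_add, MultilinearMap.map_update_smul,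
    MultilinearMap.map_update_smul]
  change _ • p + _ • q = e
  have hinv := inv_mul_cancel₀ hd
  ext j
  fin_cases j <;> simp only [Fin.zero_eta, Fin.mk_one, Pi.add_apply, Pi.smul_apply, smul_eq_mul]
  · linear_combination e 0 * hinv
  · linear_combination e 1 * hinv

theorem exists_diagonal_mem_polyImage_range {m : ℕ} (c : Equiv.Perm (Fin m) → F)
    (h : ∃ x, multilinearEval c (Matrix (Fin 2) (Fin 2) F) x 0 0 ≠ 0) :
    ∃ a b : F, a ≠ 0 ∧ b ≠ 0 ∧
      !![a, 0; 0, b] ∈ Set.range (multilinearEval c (Matrix (Fin 2) (Fin 2) F)) := by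
  obtain ⟨r, a, hra⟩ := exists_single_multilinearEval_apply_ne_zero c h
  have hk := sum_degree_of_single (![0, 1] : Fin 2 → ZMod 2) c r a hra
  simp only [single_eq_parityMatrix] at hra
  set k : Fin m → ZMod 2 := fun l =>
    (![0, 1] : Fin 2 → ZMod 2) (r l).2 - (![0, 1] : Fin 2 → ZMod 2) (r l).1
  have hk0 : ∑ l, k l = 0 := by simpa using hk
  set w : Fin m → Fin 2 → F := fun l => Pi.single (r l).1 (a l)
  have hT0 : parityEval c k w 0 ≠ 0 := by
    rw [← parityMatrix_parityEval, hk0] at hra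
    simpa [parityMatrix] using hra
  obtain ⟨x, hx, hx'⟩ := MultilinearMap.exists_ne_zero_and_ne_zero
    ((LinearMap.proj (R := F) (φ := fun _ : Fin 2 => F) 0).compMultilinearMap (parityEval c k))
    ((LinearMap.proj (R := F) (φ := fun _ : Fin 2 => F) 1).compMultilinearMap (parityEval c k))
    ⟨w, hT0⟩ ⟨fun l j => w l (1 - j), by
      simp only [LinearMap.compMultilinearMap_apply, LinearMap.proj_apply]
      rw [parityEval_swap]
      simpa using hT0⟩
  refine ⟨_, _, hx, hx', fun l => parityMatrix F (k l) (x l), ?_⟩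
  rw [← parityMatrix_parityEval, hk0]
  simp [parityMatrix]

/-! ### Passage to `D` and factorization of matrices. -/

variable {D : Type*} [DivisionRing D] [Algebra F D]

theorem commute_scalar_mapMatrix (d : D) (A : Matrix (Fin 2) (Fin 2) F) :
    Commute (Matrix.scalar (Fin 2) d) ((Algebra.ofId F D).mapMatrix A) := by
  ext i j
  simp [Matrix.mul_apply, Matrix.diagonal_apply, Algebra.ofId_apply, Algebra.commutes]

theorem multilinearEval_update_map_mul {m : ℕ} (c : Equiv.Perm (Fin m) → F) {A B : Type*} [Ring A]
    [Algebra F A] [Ring B] [Algebra F B] (φ : A →ₐ[F] B) (x : Fin m → A) (i : Fin m) (u : A)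
    {z : B} (hz : ∀ a, Commute z (φ a)) :
    multilinearEval c B (Function.update (fun l => φ (x l)) i (φ u * z)) =
      φ (multilinearEval c A (Function.update x i u)) * z := by
  rw [← multilinearEval_map,
    ← multilinearEval_update_mul c (fun l => φ (Function.update x i u l)) i z fun j => hz _]
  congr 1
  funext l
  by_cases hl : l = i
  · subst hl; simp
  · simp [hl]

theorem antidiagonal_mem_range {m : ℕ} (c : Equiv.Perm (Fin m) → F)
    (h : ∃ x, multilinearEval c (Matrix (Fin 2) (Fin 2) F) x 0 1 ≠ 0) (d e : D) :
    !![0, d; e, 0] ∈ Set.range (multilinearEval c (Matrix (Fin 2) (Fin 2) D)) := by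
  obtain ⟨k, x, i, hk, hs⟩ := exists_parityEval_surjective c h
  obtain ⟨u, hu⟩ := hs ![1, 0]
  obtain ⟨v, hv⟩ := hs ![0, 1]
  let φ := (Algebra.ofId F D).mapMatrix (m := Fin 2)
  have key : ∀ w, multilinearEval c (Matrix (Fin 2) (Fin 2) F)
      (Function.update (fun l => parityMatrix F (k l) (x l)) i (parityMatrix F (k i) w)) =
      parityMatrix F 1 (parityEval c k (Function.update x i w)) := by
    intro w
    rw [← hk, parityMatrix_parityEval]
    congr 1
    funext l
    by_cases hl : l = i
    · subst hl; simp
    · simp [hl]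
  refine ⟨Function.update (fun l => φ (parityMatrix F (k l) (x l))) i
    (φ (parityMatrix F (k i) u) * Matrix.scalar (Fin 2) d +
      φ (parityMatrix F (k i) v) * Matrix.scalar (Fin 2) e), ?_⟩
  rw [MultilinearMap.map_update_add,
    multilinearEval_update_map_mul c φ _ i _ (commute_scalar_mapMatrix d),
    multilinearEval_update_map_mul c φ _ i _ (commute_scalar_mapMatrix e), key, key, hu, hv]
  ext p q
  fin_cases p <;> fin_cases q <;> simp [φ, parityMatrix, Matrix.mul_apply, Matrix.diagonal_apply]

/-- A set of matrices closed under conjugation containing all antidiagonal matrices contains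
these matrices as well. -/
theorem mem_of_antidiagonal_mem {S : Set (Matrix (Fin 2) (Fin 2) D)}
    (hS : ∀ u w y, u * w = 1 → w * u = 1 → y ∈ S → u * y * w ∈ S)
    (hanti : ∀ d e, !![0, d; e, 0] ∈ S) (s t : D) : !![s, t; 1, -s] ∈ S := by
  have h := hS !![1, s; 0, 1] !![1, -s; 0, 1] !![0, s * s + t; 1, 0]
    (by simp [Matrix.one_fin_two]) (by simp [Matrix.one_fin_two]) (hanti _ _)
  convert h using 1
  simp

theorem exists_mul_eq_of_antidiagonal_mem {S T : Set (Matrix (Fin 2) (Fin 2) D)}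
    (hS : ∀ u w y, u * w = 1 → w * u = 1 → y ∈ S → u * y * w ∈ S)
    (hT : ∀ u w y, u * w = 1 → w * u = 1 → y ∈ T → u * y * w ∈ T)
    (hSa : ∀ d e, !![0, d; e, 0] ∈ S) (hTa : ∀ d e, !![0, d; e, 0] ∈ T)
    (hSd : ∃ a b, a ≠ 0 ∧ b ≠ 0 ∧ !![a, 0; 0, b] ∈ S) (A : Matrix (Fin 2) (Fin 2) D) :
    ∃ y ∈ S, ∃ z ∈ T, y * z = A := by
  have conj : ∀ {u w A : Matrix (Fin 2) (Fin 2) D}, u * w = 1 → w * u = 1 →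
      (∃ y ∈ S, ∃ z ∈ T, y * z = A) → ∃ y ∈ S, ∃ z ∈ T, y * z = u * A * w := by
    rintro u w _ huw hwu ⟨y, hy, z, hz, rfl⟩
    refine ⟨_, hS u w y huw hwu hy, _, hT u w z huw hwu hz, ?_⟩
    simp only [mul_assoc]
    rw [← mul_assoc w u, hwu, one_mul]
  have companion : ∀ a b : D, ∃ y ∈ S, ∃ z ∈ T, y * z = !![0, a; 1, b] := by
    intro a b
    -- Only this case needs the diagonal element of `S`.
    by_cases hb : b = 0
    · obtain ⟨p, q, hp, hq, hpq⟩ := hSd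
      exact ⟨_, hpq, _, hTa (p⁻¹ * a) q⁻¹, by simp [hb, hp, hq]⟩
    by_cases ha : a = 0
    · exact ⟨_, hSa 0 1, _, mem_of_antidiagonal_mem hT hTa 1 b, by
        ext i j
        fin_cases i <;> fin_cases j <;> simp [ha]⟩
    have h : ∃ y ∈ S, ∃ z ∈ T, y * z = !![b, a; 1, 0] :=
      ⟨_, hSa b (-(b⁻¹ * a))⁻¹, _, mem_of_antidiagonal_mem hT hTa (-(b⁻¹ * a)) 0, by
        simp [hb, mul_assoc, inv_mul_cancel₀ ha]⟩
    have h' := conj (u := !![1, -b; 0, 1]) (w := !![1, b; 0, 1]) (by simp [Matrix.one_fin_two])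
      (by simp [Matrix.one_fin_two]) h
    simpa using h'
  have lower : ∀ a b c d : D, c ≠ 0 → ∃ y ∈ S, ∃ z ∈ T, y * z = !![a, b; c, d] := by
    intro a b c d hc
    -- The columns of `u` are e₀ and its image under the target matrix, a basis because `c ≠ 0`; in
    -- it the matrix has companion form.
    have h := conj (u := !![1, a; 0, c]) (w := !![1, -(a * c⁻¹); 0, c⁻¹])
      (by simp [Matrix.one_fin_two, hc]) (by simp [Matrix.one_fin_two, hc])
      (companion ((b - a * c⁻¹ * d) * c) (a + c⁻¹ * d * c))
    convert h using 5
    simp [hc, mul_add, add_mul, sub_mul, mul_assoc]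
  rw [A.eta_fin_two]
  by_cases hc : A 1 0 = 0
  · by_cases hb : A 0 1 = 0
    · exact ⟨_, hSa (A 0 0) (A 1 1), _, hTa 1 1, by simp [hb, hc]⟩
    · have h := conj (swap_mul_swap D) (swap_mul_swap D) (lower (A 1 1) (A 1 0) (A 0 1) (A 0 0) hb)
      rw [swap_conj] at h
      simpa using h
  · exact lower _ _ _ _ hc

end Values

/-! ### Assembly of the theorem. -/

theorem IsMultilinearIn.values {F D : Type*} [Field F] [DivisionRing D] [Algebra F D]
    {X : Finset ℕ} {p : FreeAlgebra F ℕ} (hp : IsMultilinearIn X p)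
    (h0 : polyImage (Matrix (Fin 2) (Fin 2) F) p ≠ {0})
    (hc : polyImage (Matrix (Fin 2) (Fin 2) F) p ≠ Set.center (Matrix (Fin 2) (Fin 2) F)) :
    (∀ d e : D, !![0, d; e, 0] ∈ polyImage (F := F) (Matrix (Fin 2) (Fin 2) D) p) ∧
      ∃ a b : D, a ≠ 0 ∧ b ≠ 0 ∧
        !![a, 0; 0, b] ∈ polyImage (F := F) (Matrix (Fin 2) (Fin 2) D) p := by
  obtain ⟨m, v, c, hm, -, rfl⟩ := hp
  rw [polyImage_eq_range] at h0 hc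
  have h01 := exists_multilinearEval_zero_one_ne_zero hm c h0 hc
  constructor
  · rw [polyImage_eq_range]
    exact antidiagonal_mem_range c h01
  · obtain ⟨a, b, ha, hb, hab⟩ := exists_diagonal_mem_polyImage_range c
      (exists_multilinearEval_zero_zero_ne_zero c h01)
    rw [← polyImage_eq_range c v] at hab
    have h := map_mem_polyImage ((Algebra.ofId F D).mapMatrix (m := Fin 2)) hab
    refine ⟨algebraMap F D a, algebraMap F D b, by simpa, by simpa, ?_⟩
    convert h using 1
    ext i j
    fin_cases i <;> fin_cases j <;> simp [Algebra.ofId_apply]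

theorem theorem4p6 {F D : Type*} [Field F] [DivisionRing D] [Algebra F D] [Algebra.IsCentral F D]
    (p p₁ p₂ : FreeAlgebra F ℕ) (hp : p = p₁ * p₂)
    (X₁ X₂ : Finset ℕ) (hX : Disjoint X₁ X₂)
    (h₁ : IsMultilinearIn X₁ p₁) (h₂ : IsMultilinearIn X₂ p₂)
    (h₁_zero : polyImage (Matrix (Fin 2) (Fin 2) F) p₁ ≠ {0})
    (h₁_center : polyImage (Matrix (Fin 2) (Fin 2) F) p₁ ≠
      Set.center (Matrix (Fin 2) (Fin 2) F))
    (h₂_zero : polyImage (Matrix (Fin 2) (Fin 2) F) p₂ ≠ {0})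
    (h₂_center : polyImage (Matrix (Fin 2) (Fin 2) F) p₂ ≠
      Set.center (Matrix (Fin 2) (Fin 2) F)) :
    polyImage (Matrix (Fin 2) (Fin 2) D) p = Set.univ := by
  subst hp
  obtain ⟨ha₁, hd₁⟩ := h₁.values (D := D) h₁_zero h₁_center
  obtain ⟨ha₂, -⟩ := h₂.values (D := D) h₂_zero h₂_center
  refine Set.eq_univ_of_forall fun A => ?_
  obtain ⟨y, hy, z, hz, rfl⟩ := exists_mul_eq_of_antidiagonal_mem
    (fun _ _ _ huw hwu => conj_mem_polyImage huw hwu)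
    (fun _ _ _ huw hwu => conj_mem_polyImage huw hwu) ha₁ ha₂ hd₁ A
  exact mul_mem_polyImage_mul hX h₁ h₂ hy hz
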